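/- Let $A$ be a complete discrete valuation ring with maximal ideal $\mathfrak p$, finite residue field of cardinality $N(\mathfrak p)$, and fraction field $K$; put $P=\{\mathfrak p\}$. Let $K^{\mathrm{sep}}$ be a separable closure of $K$, let $G_K=\mathrm{Gal}(K^{\mathrm{sep}}/K)$, let $I_K\subseteq G_K$ be the inertia subgroup, and let $F\in G_K/I_K$ be the Frobenius element, i.e. the class of the $\sigma\in G_K$ that induce $x\mapsto x^{N(\mathfrak p)}$ on the residue field of the integral closure of $A$ in $K^{\mathrm{sep}}$. For a set $P$ of maximal ideals with finite residue fields, a $\Lambda_{A,P}$-structure on a commutative $A$-algebra $B$ is a family $(\psi_{\mathfrak q})_{\mathfrak q\in P}$ of commuting $A$-algebra endomorphisms of $B$ such that each $\psi_{\mathfrak q}$ induces $x\mapsto x^{N(\mathfrak q)}$ on $B/\mathfrak qB$. Let $E$ be a finite étale $K$-algebra with a $\Lambda_{A,P}$-structure (here, a single endomorphism $\psi_{\mathfrak p}$). An integral $\Lambda_{A,P}$-model of $E$ is an $A$-subalgebra $B\subseteq E$ that is finite and flat as an $A$-module, such that $K\otimes_A B\to E$ is bijective and such that the $\psi_{\mathfrak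 q}$ restrict to a $\Lambda_{A,P}$-structure on $B$. Let $S=\mathrm{Hom}_{K\text{-alg}}(E,K^{\mathrm{sep}})$, and let $\mathrm{Id}_P$ be the multiplicative monoid of nonzero ideals of $A$ divisible only by primes in $P$ (here, $\mathrm{Id}_P=\{\mathfrak p^n: n\ge 0\}$). The monoid $G_K\times\mathrm{Id}_P$ acts on $S$ by $(\sigma,\mathfrak p^n)\cdot s=\sigma\circ s\circ\psi_{\mathfrak p}^{\,n}$. Put $S_{\mathrm{unr}}=\bigcap_{n\ge 0}\mathfrak p^nS$. Then $E$ has an integral $\Lambda_{A,P}$-model if and only if the following two conditions hold: 1. the group $I_K$ acts trivially on $S_{\mathrm{unr}}$; 2. the elements $\mathfrak p\in\mathrm{Id}_P$ and $F\in G_K/I_K$ act in the same way on $S_{\mathrm{unr}}$. -/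

import Mathlib

open IsLocalRing UniqueFactorizationMonoid

noncomputable section

namespace LambdaRing

section Basic

variable (A : Type*) [CommRing A]

/-- An `A`-algebra endomorphism `ψ` of `B` is a Frobenius lift at the maximal ideal `p` if it
induces `x ↦ x ^ N(p)` on `B / pB`, where `N(p)` is the cardinality of `A / p`. -/
def IsFrobeniusLift {A : Type*} [CommRing A] {B : Type*} [CommRing B] [Algebra A B]
    (p : MaximalSpectrum A) (ψ : B →ₐ[A] B) : Prop :=
  ∀ x : B, ψ x - x ^ Nat.card (A ⧸ p.asIdeal) ∈ p.asIdeal.map (algebraMap A B)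

/-- A `Λ_{A,P}`-structure on the `A`-algebra `B`: a family of commuting Frobenius lifts,
one at each `p ∈ P`. -/
structure LambdaStructure (P : Set (MaximalSpectrum A)) (B : Type*) [CommRing B] [Algebra A B] where
  /-- the operator `ψ_p` -/
  psi : P → (B →ₐ[A] B)
  isFrobeniusLift : ∀ p : P, IsFrobeniusLift p.1 (psi p)
  comm : ∀ p q : P, (psi p).comp (psi q) = (psi q).comp (psi p)

/-- `Id_P`: the monoid, under ideal multiplication, of the nonzero ideals of `A` that are
divisible only by the primes in `P`. -/
def IdP [IsDedekindDomain A] (P : Set (MaximalSpectrum A)) : Submonoid (Ideal A) where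
  carrier := {a | a ≠ ⊥ ∧ ∀ q : MaximalSpectrum A, q.asIdeal ∣ a → q ∈ P}
  one_mem' := by
    refine ⟨by rw [Ideal.one_eq_top]; exact top_ne_bot, fun q hq => ?_⟩
    exact absurd (Ideal.isUnit_iff.mp (isUnit_of_dvd_one hq)) q.isMaximal.ne_top
  mul_mem' := by
    rintro a b ⟨ha, ha'⟩ ⟨hb, hb'⟩
    refine ⟨mul_ne_zero ha hb, fun q hq => ?_⟩
    rw [Ideal.dvd_iff_le] at hq
    rcases (q.isMaximal.isPrime.mul_le).mp hq with h | h
    · exact ha' q (Ideal.dvd_iff_le.mpr h)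
    · exact hb' q (Ideal.dvd_iff_le.mpr h)

variable {A}

/-- A nonzero prime in `P`, as an element of `Id_P`. -/
def IdP.ofPrime [IsDedekindDomain A] {P : Set (MaximalSpectrum A)} (p : P)
    (hp : p.1.asIdeal ≠ ⊥) : IdP A P :=
  ⟨p.1.asIdeal, hp, fun q hq => by
    have h : q = p.1 := MaximalSpectrum.ext
      (p.1.isMaximal.eq_of_le q.isMaximal.ne_top (Ideal.dvd_iff_le.mp hq)).symm
    exact h ▸ p.2⟩

namespace LambdaStructure

variable {P : Set (MaximalSpectrum A)} {B : Type*} [CommRing B] [Algebra A B]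

open Classical in
/-- `ψ_q` for `q ∈ P`, extended by the identity to all other ideals. -/
def psiAux (L : LambdaStructure A P B) (q : Ideal A) : B →ₐ[A] B :=
  if h : ∃ p : P, p.1.asIdeal = q then L.psi h.choose else 1

theorem psiAux_asIdeal (L : LambdaStructure A P B) (p : P) :
    L.psiAux p.1.asIdeal = L.psi p := by
  have h : ∃ p' : P, p'.1.asIdeal = p.1.asIdeal := ⟨p, rfl⟩
  rw [psiAux, dif_pos h]
  congr 1
  exact Subtype.ext (MaximalSpectrum.ext h.choose_spec)

theorem psiAux_commute (L : LambdaStructure A P B) (q r : Ideal A) :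
    Commute (L.psiAux q) (L.psiAux r) := by
  unfold psiAux
  split_ifs
  · exact L.comm _ _
  · exact Commute.one_right _
  · exact Commute.one_left _
  · exact Commute.one_left _

theorem psiAux_pairwise (L : LambdaStructure A P B) (s : Multiset (Ideal A)) :
    {x | x ∈ s.map L.psiAux}.Pairwise Commute := by
  intro x hx y hy _
  obtain ⟨q, -, rfl⟩ := Multiset.mem_map.mp hx
  obtain ⟨r, -, rfl⟩ := Multiset.mem_map.mp hy
  exact L.psiAux_commute q r

variable [IsDedekindDomain A]

/-- The monoid map `a ↦ ψ_a` on `Id_P` that extends `p ↦ ψ_p`: if `a = p₁ ⋯ pᵣ` is the prime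
factorization, then `ψ_a = ψ_{p₁} ∘ ⋯ ∘ ψ_{pᵣ}`. -/
def psiIdeal (L : LambdaStructure A P B) : IdP A P →* (B →ₐ[A] B) where
  toFun a := ((normalizedFactors a.1).map L.psiAux).noncommProd (L.psiAux_pairwise _)
  map_one' := by
    have h : normalizedFactors ((1 : IdP A P) : Ideal A) = 0 := normalizedFactors_one
    simp only [h, Multiset.map_zero, Multiset.noncommProd_empty]
  map_mul' a b := by
    have h : normalizedFactors ((a * b : IdP A P) : Ideal A)
        = normalizedFactors a.1 + normalizedFactors b.1 := normalizedFactors_mul a.2.1 b.2.1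
    simp only [h, Multiset.map_add]
    exact Multiset.noncommProd_add _ _ _

/-- On the primes in `P` the map `a ↦ ψ_a` is the given one. -/
theorem psiIdeal_ofPrime (L : LambdaStructure A P B) (p : P) (hp : p.1.asIdeal ≠ ⊥) :
    L.psiIdeal (IdP.ofPrime p hp) = L.psi p := by
  have hprime : Irreducible p.1.asIdeal :=
    ((Ideal.prime_iff_isPrime hp).mpr p.1.isMaximal.isPrime).irreducible
  have h : normalizedFactors ((IdP.ofPrime p hp : IdP A P) : Ideal A) = {p.1.asIdeal} := by
    change normalizedFactors p.1.asIdeal = _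
    rw [normalizedFactors_irreducible hprime, normalize_eq]
  rw [← L.psiAux_asIdeal p]
  change ((normalizedFactors ((IdP.ofPrime p hp : IdP A P) : Ideal A)).map L.psiAux).noncommProd
    (L.psiAux_pairwise _) = _
  simp only [h, Multiset.map_singleton]
  rw [Multiset.noncommProd_eq_pow_card _ _ (L.psiAux p.1.asIdeal)
    (fun x hx => Multiset.mem_singleton.mp hx), Multiset.card_singleton, pow_one]

end LambdaStructure

end Basic

section OverFractionField

variable {A : Type*} [CommRing A] (K : Type*) [Field K] [Algebra A K] [IsFractionRing A K]

/-- An `A`-algebra endomorphism of a `K`-algebra, viewed as a `K`-algebra endomorphism,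
where `K` is the fraction field of `A`. -/
def extendScalars {E : Type*} [CommRing E] [Algebra K E] [Algebra A E] [IsScalarTower A K E]
    (f : E →ₐ[A] E) : E →ₐ[K] E :=
  { f.toRingHom with
    commutes' := by
      have h : f.toRingHom.comp (algebraMap K E) = algebraMap K E := by
        apply IsLocalization.ringHom_ext (nonZeroDivisors A)
        ext a
        simp [← IsScalarTower.algebraMap_apply A K E]
      exact fun x => RingHom.congr_fun h x }

theorem extendScalars_apply {E : Type*} [CommRing E] [Algebra K E] [Algebra A E]
    [IsScalarTower A K E] (f : E →ₐ[A] E) (x : E) : extendScalars K f x = f x := rfl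

namespace LambdaStructure

variable {P : Set (MaximalSpectrum A)}
  {E : Type*} [CommRing E] [Algebra K E] [Algebra A E] [IsScalarTower A K E]

/-- The action of the monoid `Gal(Kˢ/K) × Id_P` on the set of `K`-algebra maps `s : E → Kˢ`,
given by `(σ, a) • s = σ ∘ s ∘ ψ_a`. -/
def action [IsDedekindDomain A] (L : LambdaStructure A P E)
    (Ksep : Type*) [Field Ksep] [Algebra K Ksep] :
    Gal(Ksep/K) × IdP A P →* Function.End (E →ₐ[K] Ksep) where
  toFun g s := ((g.1 : Ksep →ₐ[K] Ksep).comp s).comp (extendScalars K (L.psiIdeal g.2))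
  map_one' := by
    funext s
    ext x
    change s (L.psiIdeal 1 x) = s x
    rw [map_one, AlgHom.one_apply]
  map_mul' g h := by
    funext s
    ext x
    change g.1 (h.1 (s (L.psiIdeal (g.2 * h.2) x)))
      = g.1 (h.1 (s (L.psiIdeal h.2 (L.psiIdeal g.2 x))))
    rw [mul_comm, map_mul, AlgHom.mul_apply]

/-- `B ⊆ E` is an integral `Λ_{A,P}`-model of `E`: a sub-`Λ_{A,P}`-ring which is finite and flat
as an `A`-module and for which the induced map `K ⊗[A] B → E` is bijective. -/
structure IsIntegralModel (L : LambdaStructure A P E) (B : Subalgebra A E) : Prop where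
  /-- the operators of `E` restrict to a `Λ_{A,P}`-structure on `B` -/
  exists_lambdaStructure :
    ∃ L' : LambdaStructure A P B, ∀ (p : P) (b : B), ((L'.psi p b : B) : E) = L.psi p (b : E)
  finite : Module.Finite A B
  flat : Module.Flat A B
  bijective : Function.Bijective (B.val.toLinearMap.liftBaseChange K)

end LambdaStructure

end OverFractionField

section Local

variable (A : Type*) [CommRing A] [IsDomain A] [IsDiscreteValuationRing A]

/-- The set `P` consisting of the single maximal ideal of `A`. -/
def localP : Set (MaximalSpectrum A) := {⟨maximalIdeal A, inferInstance⟩}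

/-- The maximal ideal of `A` as an element of `Id_P`. -/
def localPrime : IdP A (localP A) :=
  IdP.ofPrime ⟨⟨maximalIdeal A, inferInstance⟩, rfl⟩ (IsDiscreteValuationRing.not_a_field A)

/-- `S_unr = ⋂_{n ≥ 0} pⁿ S`, where `S` is the set of `K`-algebra maps `E → Kˢ`. -/
def LambdaStructure.Sunr {A : Type*} [CommRing A] [IsDomain A] [IsDiscreteValuationRing A]
    (K : Type*) [Field K] [Algebra A K] [IsFractionRing A K]
    {E : Type*} [CommRing E] [Algebra K E] [Algebra A E] [IsScalarTower A K E]
    (L : LambdaStructure A (localP A) E) (Ksep : Type*) [Field Ksep] [Algebra K Ksep] :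
    Set (E →ₐ[K] Ksep) :=
  ⋂ n : ℕ, Set.range (L.action K Ksep (1, localPrime A ^ n))

end Local

end LambdaRing

end

/-!
Let `O` be the integral closure of `A` in `Kˢ`, let `q` be the cardinality of the residue field,
let `π` be a uniformizer and let `ψ` be the given operator on `E`. As the set `S` of homomorphisms
`E → Kˢ` is finite, `S_unr` is the set of periodic points of `s ↦ s ∘ ψ`
(`LambdaStructure.mem_Sunr_iff`).

Suppose that `B` is an integral model. If `s ∘ ψᵐ = s`, then `s` is determined on `B` by its
reduction modulo `Q`: for two such maps with the same reduction, the ideal `J` generated by the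
values of their difference satisfies `J = Q J`, since `ψᵐ` lifts a power of Frobenius and the
`qᵐ`-th power map has derivative zero in the residue characteristic; so `J = 0` by Nakayama's lemma
(`algHom_eq_of_sub_mem`). Both conditions are equalities of elements of `S_unr` that clearly hold
modulo `Q`.

Conversely, suppose that the two conditions hold. By Fitting's lemma `E` is the direct sum of the
kernel and the image of `ψⁿ` for large `n`. The model is `R + I`, where `R` consists of the integral
elements in the image and `I` is a lattice in the kernel, stable under multiplication by integral
elements, on which `ψ` and the `q`-th power map both vanish modulo `π` (`modelSubalgebra`). It
remains to see that `(ψ r - r ^ q) / π` is integral for `r` in `R`. Every `s` in `S` restricts on the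
image of `ψⁿ` to an element of `S_unr`, so the conditions give `s (ψ r - r ^ q) = F y - y ^ q`,
where `y = s r`; this lies in `Q` and is fixed by inertia. So what is needed is that inertia invariants in
`Q` are divisible by `π` in `O`.

For this, let `T` be the set of `t` in `O` with `t ^ (qᵐ) = t` for some `m > 0`. Since
`X ^ (qᵐ) - X` splits over `Kˢ`, each residue class of `O` contains an element of `T`, and hence an
automorphism that fixes `T` lies in the inertia group; by Galois theory, inertia invariants lie in
`K(T)` (`mem_adjoin_teichmuller_of_fixed`). On the ring `A[T]` some power of the `q`-th power map is
the identity modulo `π`, while each of its elements in `Q` is nilpotent modulo `π`, because otherwise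
it would give a nontrivial idempotent modulo `π` that lifts by Hensel's lemma. So the elements of `Q`
in `A[T]` are divisible by `π` in `A[T]`, and this extends to the integral elements of `K(T)`
(`dvd_of_mem_adjoin_teichmuller`).
-/

namespace LambdaRing

/-! ### Eventually periodic points of a self-map of a finite set -/

theorem iterate_mem_periodicPts {α : Type*} [Finite α] (f : α → α) (x : α) {n : ℕ}
    (hn : Nat.card α ≤ n) : f^[n] x ∈ Function.periodicPts f := by
  have := Fintype.ofFinite α
  -- Two of the `n + 1` points `x, f x, …, fⁿ x` coincide.
  obtain ⟨i, hi, j, hj, hij, h⟩ := Finset.exists_ne_map_eq_of_card_lt_of_maps_to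
    (s := Finset.range (n + 1)) (t := Finset.univ) (f := fun i => f^[i] x)
    (by rw [Finset.card_range, Finset.card_univ, ← Nat.card_eq_fintype_card]; omega)
    (fun _ _ => Finset.mem_univ _)
  wlog hlt : i < j generalizing i j
  · exact this j hj i hi hij.symm h.symm (by omega)
  refine Function.mk_mem_periodicPts (n := j - i) (by omega) ?_
  have hi' : i ≤ n := by simpa [Nat.lt_succ_iff] using hi
  change f^[j - i] (f^[n] x) = f^[n] x
  rw [← Function.iterate_add_apply, show j - i + n = (n - i) + j by omega,
    Function.iterate_add_apply, ← h, ← Function.iterate_add_apply, Nat.sub_add_cancel hi']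

theorem mem_range_iterate_of_mem_periodicPts {α : Type*} {f : α → α} {x : α}
    (hx : x ∈ Function.periodicPts f) (n : ℕ) : x ∈ Set.range f^[n] := by
  obtain ⟨d, hd, h⟩ := hx
  refine ⟨f^[n * d - n] x, ?_⟩
  rw [← Function.iterate_add_apply, Nat.add_sub_cancel' (Nat.le_mul_of_pos_right n hd)]
  exact (h.const_mul n)

theorem exists_pow_isIdempotentElem {M : Type*} [Monoid M] [Finite M] (x : M) :
    ∃ n, 0 < n ∧ IsIdempotentElem (x ^ n) := by
  obtain ⟨d, hd, h⟩ := iterate_mem_periodicPts (x * ·) (1 : M) le_rfl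
  set c := Nat.card M
  have hx : ∀ k, x ^ (k * d + c) = x ^ c := fun k => by
    have := h.const_mul k
    rwa [Function.IsPeriodicPt, Function.IsFixedPt, ← Function.iterate_add_apply,
      mul_left_iterate_apply_one, mul_left_iterate_apply_one] at this
  have hc : 0 < c := Nat.card_pos
  have hcd : c ≤ c * d := Nat.le_mul_of_pos_right c hd
  refine ⟨c * d, by positivity, ?_⟩
  rw [IsIdempotentElem, ← pow_add]
  calc x ^ (c * d + c * d) = x ^ (c * d + c) * x ^ (c * d - c) := by
        rw [← pow_add]; congr 1; omega
    _ = x ^ (c * d) := by rw [hx, ← pow_add]; congr 1; omega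

/-! ### Extended ideals and congruences -/

theorem algHom_apply_mem_map {A B C : Type*} [CommRing A] [CommRing B] [CommRing C] [Algebra A B]
    [Algebra A C] (f : B →ₐ[A] C) (I : Ideal A) {x : B} (hx : x ∈ I.map (algebraMap A B)) :
    f x ∈ I.map (algebraMap A C) := by
  have h : I.map (algebraMap A B) ≤ (I.map (algebraMap A C)).comap f :=
    Ideal.map_le_iff_le_comap.mpr fun a ha => by
      rw [Ideal.mem_comap, Ideal.mem_comap, f.commutes]
      exact Ideal.mem_map_of_mem _ ha
  exact h hx

/-! ### Lifting idempotents to finite algebras over a complete local ring -/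

/-- Unlike the comparison with the tensor product, this needs no relation between the universes of
the ring and of the module. -/
theorem isAdicComplete_of_finite {R : Type*} [CommRing R] [IsNoetherianRing R] [IsLocalRing R]
    [IsAdicComplete (maximalIdeal R) R] (M : Type*) [AddCommGroup M] [Module R M]
    [Module.Finite R M] : IsAdicComplete (maximalIdeal R) M := by
  have hpre : IsPrecomplete (maximalIdeal R) M := by
    rw [← AdicCompletion.of_surjective_iff]
    intro y
    obtain ⟨z, rfl⟩ := AdicCompletion.ofTensorProduct_surjective_of_finite (maximalIdeal R) M y
    induction z with
    | zero => exact ⟨0, by simp⟩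
    | add a b ha hb =>
      obtain ⟨a', ha⟩ := ha
      obtain ⟨b', hb⟩ := hb
      exact ⟨a' + b', by rw [map_add, map_add, ha, hb]⟩
    | tmul r m =>
      obtain ⟨r, rfl⟩ := AdicCompletion.of_surjective (maximalIdeal R) R r
      refine ⟨r • m, ?_⟩
      rw [AdicCompletion.ofTensorProduct_tmul, map_smul]
      rfl
  exact { }

section Complete

variable {A : Type*} [CommRing A] [IsLocalRing A] [IsNoetherianRing A]
  [IsAdicComplete (maximalIdeal A) A] [Finite (ResidueField A)]

/-- A finite domain over a complete local ring has no nontrivial idempotents modulo the maximal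
ideal of the base, because they would lift. -/
theorem exists_pow_mem_or_pow_sub_one_mem {C : Type*} [CommRing C] [IsDomain C] [Algebra A C]
    [Module.Finite A C] (x : C) :
    ∃ n, 0 < n ∧ (x ^ n ∈ (maximalIdeal A).map (algebraMap A C) ∨
      x ^ n - 1 ∈ (maximalIdeal A).map (algebraMap A C)) := by
  set J := (maximalIdeal A).map (algebraMap A C)
  have : IsAdicComplete J C :=
    (IsAdicComplete.map_algebraMap_iff _ _).mpr (isAdicComplete_of_finite C)
  have hfin : Finite (C ⧸ J) := by
    have : Module.Finite (A ⧸ maximalIdeal A) (C ⧸ J) :=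
      Module.Finite.of_restrictScalars_finite A _ _
    have : Finite (A ⧸ maximalIdeal A) := ‹Finite (ResidueField A)›
    exact Module.finite_of_finite (A ⧸ maximalIdeal A)
  obtain ⟨n, hn, hid⟩ := exists_pow_isIdempotentElem (Ideal.Quotient.mk J x)
  refine ⟨n, hn, ?_⟩
  rw [← map_pow] at hid
  have hid' : Ideal.Quotient.mk J (x ^ n * x ^ n - x ^ n) = 0 := by
    rw [map_sub, map_mul, hid, sub_self]
  obtain ⟨a, ha, hax⟩ := HenselianRing.is_henselian (I := J) (Polynomial.X ^ 2 - Polynomial.X)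
    (by monicity!) (x ^ n)
    (by simpa [sq] using Ideal.Quotient.eq_zero_iff_mem.mp hid')
    (by
      -- `2e - 1` is its own inverse for every idempotent `e`.
      refine IsUnit.of_mul_eq_one (Ideal.Quotient.mk J (2 * x ^ n - 1)) ?_
      rw [← map_mul, ← map_one (Ideal.Quotient.mk J), ← sub_eq_zero, ← map_sub]
      have : (Polynomial.derivative (Polynomial.X ^ 2 - Polynomial.X : Polynomial C)).eval (x ^ n) *
          (2 * x ^ n - 1) - 1 = 4 * (x ^ n * x ^ n - x ^ n) := by
        simp; ring
      rw [this, map_mul, hid', mul_zero])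
  have ha' : a * (a - 1) = 0 := by
    have : a ^ 2 - a = 0 := by simpa using ha
    linear_combination this
  rcases mul_eq_zero.mp ha' with h | h
  · left
    simpa [h] using J.neg_mem hax
  · right
    have : x ^ n - 1 = -(a - x ^ n) + (a - 1) := by ring
    rw [this, h, add_zero]
    exact J.neg_mem hax

/-- An integral domain over a complete local ring is local, in the form that every element of a
prime above the maximal ideal is nilpotent modulo that maximal ideal. -/
theorem exists_pow_mem_map_maximalIdeal {B : Type*} [CommRing B] [IsDomain B] [Algebra A B]
    [Algebra.IsIntegral A B] {P : Ideal B} (hP : P ≠ ⊤)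
    (hmP : (maximalIdeal A).map (algebraMap A B) ≤ P) {x : B} (hx : x ∈ P) :
    ∃ n, 0 < n ∧ x ^ n ∈ (maximalIdeal A).map (algebraMap A B) := by
  have hfin : Module.Finite A (Algebra.adjoin A {x}) :=
    Module.Finite.iff_fg.mpr (Algebra.IsIntegral.isIntegral (R := A) x).fg_adjoin_singleton
  let x' : Algebra.adjoin A {x} := ⟨x, Algebra.self_mem_adjoin_singleton A x⟩
  have hmap : ∀ y ∈ (maximalIdeal A).map (algebraMap A (Algebra.adjoin A {x})),
      (y : B) ∈ (maximalIdeal A).map (algebraMap A B) :=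
    fun _ => algHom_apply_mem_map (Algebra.adjoin A {x}).val _
  obtain ⟨n, hn, h | h⟩ := exists_pow_mem_or_pow_sub_one_mem (A := A) x'
  · exact ⟨n, hn, hmap _ h⟩
  · exfalso
    have h1 : x ^ n - 1 ∈ P := hmP (hmap _ h)
    have h2 : x ^ n ∈ P := P.pow_mem_of_mem hx n hn
    exact hP ((Ideal.eq_top_iff_one P).mpr (by simpa using P.sub_mem h2 h1))

end Complete

/-! ### Algebras over a discrete valuation ring generated by Teichmüller elements -/

section Teichmuller

variable (A : Type*) [CommRing A] [IsLocalRing A]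

/-- The cardinality of the residue field (`0` if it is infinite). -/
local notation "q" => Nat.card (A ⧸ maximalIdeal A)

/-- The Teichmüller elements of an `A`-algebra: the solutions of `x ^ (qᵐ) = x` for some `m > 0`,
where `q` is the cardinality of the residue field of `A`. -/
def teichmuller (B : Type*) [CommRing B] : Set B :=
  {t | ∃ m, 0 < m ∧ t ^ q ^ m = t}

variable [Finite (ResidueField A)]

theorem exists_card_eq_prime_pow :
    ∃ p k : ℕ, p.Prime ∧ 0 < k ∧ q = p ^ k ∧ (p : A) ∈ maximalIdeal A := by
  have := Fintype.ofFinite (ResidueField A)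
  obtain ⟨p, hp, k, hprime, hk⟩ := FiniteField.card' (ResidueField A)
  refine ⟨p, k, hprime, k.2, by rw [← hk, ← Nat.card_eq_fintype_card]; rfl, ?_⟩
  rw [← residue_eq_zero_iff, map_natCast]
  exact CharP.cast_eq_zero _ _

theorem two_le_card : 2 ≤ q := by
  have : Finite (A ⧸ maximalIdeal A) := ‹Finite (ResidueField A)›
  have : Nontrivial (A ⧸ maximalIdeal A) := inferInstanceAs (Nontrivial (ResidueField A))
  exact Finite.one_lt_card

theorem natCast_card_pow_mem {m : ℕ} (hm : 0 < m) : ((q ^ m : ℕ) : A) ∈ maximalIdeal A := by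
  obtain ⟨p, k, -, hk, hq, hp⟩ := exists_card_eq_prime_pow A
  rw [hq, ← pow_mul, Nat.cast_pow]
  exact Ideal.pow_mem_of_mem _ hp _ (by positivity)

variable {A}

theorem pow_card_pow_sub_self_mem (a : A) (m : ℕ) : a ^ q ^ m - a ∈ maximalIdeal A := by
  have := Fintype.ofFinite (ResidueField A)
  rw [← residue_eq_zero_iff, map_sub, map_pow, sub_eq_zero]
  have : q = Fintype.card (ResidueField A) := by rw [← Nat.card_eq_fintype_card]; rfl
  rw [this]
  exact FiniteField.pow_card_pow m _

variable {B : Type*} [CommRing B] [Algebra A B]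

theorem add_pow_card_pow_sub_mem (x y : B) (m : ℕ) :
    (x + y) ^ q ^ m - (x ^ q ^ m + y ^ q ^ m) ∈ (maximalIdeal A).map (algebraMap A B) := by
  obtain ⟨p, k, hprime, hk, hq, hp⟩ := exists_card_eq_prime_pow A
  rw [hq, ← pow_mul]
  obtain ⟨r, hr⟩ := exists_add_pow_prime_pow_eq hprime x y (k * m)
  rw [hr, add_sub_cancel_left]
  have : (p : B) ∈ (maximalIdeal A).map (algebraMap A B) := by
    simpa using Ideal.mem_map_of_mem (algebraMap A B) hp
  exact Ideal.mul_mem_right _ _ (Ideal.mul_mem_right _ _ (Ideal.mul_mem_right _ _ this))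

omit [Algebra A B] [Finite (ResidueField A)] in
theorem pow_card_pow_mul_eq {x : B} {m : ℕ} (h : x ^ q ^ m = x) (k : ℕ) :
    x ^ q ^ (m * k) = x := by
  induction k with
  | zero => simp
  | succ k ih => rw [Nat.mul_succ, pow_add, pow_mul, ih, h]

/-- In an algebra generated by Teichmüller elements, a power of the `q`-power map is the identity
modulo the maximal ideal of the base: the reduction is a union of finite fields. -/
theorem exists_pow_sub_self_mem_of_adjoin_eq_top
    (hB : Algebra.adjoin A (teichmuller A B) = ⊤) (w : B) :
    ∃ m, 0 < m ∧ w ^ q ^ m - w ∈ (maximalIdeal A).map (algebraMap A B) := by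
  set J := (maximalIdeal A).map (algebraMap A B)
  have key : ∀ (x : B) (m : ℕ), x ^ q ^ m - x ∈ J ↔
      (Ideal.Quotient.mk J x) ^ q ^ m = Ideal.Quotient.mk J x := fun x m => by
    rw [← Ideal.Quotient.eq_zero_iff_mem, map_sub, map_pow, sub_eq_zero]
  have hw : w ∈ Algebra.adjoin A (teichmuller A B) := hB ▸ Algebra.mem_top
  induction hw using Algebra.adjoin_induction with
  | mem t ht =>
    obtain ⟨m, hm, h⟩ := ht
    exact ⟨m, hm, by rw [h, sub_self]; exact J.zero_mem⟩
  | algebraMap a =>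
    refine ⟨1, one_pos, ?_⟩
    rw [← map_pow, ← map_sub]
    exact Ideal.mem_map_of_mem _ (pow_card_pow_sub_self_mem a 1)
  | add x y _ _ hx hy =>
    obtain ⟨m, hm, hx⟩ := hx
    obtain ⟨n, hn, hy⟩ := hy
    refine ⟨m * n, by positivity, ?_⟩
    have hx' := (key x (m * n)).mpr (pow_card_pow_mul_eq ((key x m).mp hx) n)
    have hy' := (key y (m * n)).mpr (by
      rw [mul_comm]; exact pow_card_pow_mul_eq ((key y n).mp hy) m)
    have := J.add_mem (add_pow_card_pow_sub_mem (A := A) x y (m * n)) (J.add_mem hx' hy')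
    convert this using 1
    ring
  | mul x y _ _ hx hy =>
    obtain ⟨m, hm, hx⟩ := hx
    obtain ⟨n, hn, hy⟩ := hy
    refine ⟨m * n, by positivity, ?_⟩
    rw [key, map_mul, mul_pow, pow_card_pow_mul_eq ((key x m).mp hx) n, mul_comm m n,
      pow_card_pow_mul_eq ((key y n).mp hy) m]

/-- An integral domain over a complete local ring that is generated by Teichmüller elements is
unramified: the primes above the maximal ideal are generated by it. -/
theorem mem_map_maximalIdeal_of_adjoin_eq_top [IsNoetherianRing A]
    [IsAdicComplete (maximalIdeal A) A] [IsDomain B] [Algebra.IsIntegral A B]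
    (hB : Algebra.adjoin A (teichmuller A B) = ⊤) {P : Ideal B} (hP : P ≠ ⊤)
    (hmP : (maximalIdeal A).map (algebraMap A B) ≤ P) {w : B} (hw : w ∈ P) :
    w ∈ (maximalIdeal A).map (algebraMap A B) := by
  set J := (maximalIdeal A).map (algebraMap A B)
  obtain ⟨n, hn, hwn⟩ := exists_pow_mem_map_maximalIdeal (A := A) hP hmP hw
  obtain ⟨m, hm, hwm⟩ := exists_pow_sub_self_mem_of_adjoin_eq_top hB w
  rw [← Ideal.Quotient.eq_zero_iff_mem, map_sub, map_pow, sub_eq_zero] at hwm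
  rw [← Ideal.Quotient.eq_zero_iff_mem, map_pow] at hwn
  rw [← Ideal.Quotient.eq_zero_iff_mem, ← pow_card_pow_mul_eq hwm n]
  refine pow_eq_zero_of_le ?_ hwn
  calc n ≤ m * n := Nat.le_mul_of_pos_left n hm
    _ ≤ q ^ (m * n) := (Nat.lt_pow_self (two_le_card A)).le

end Teichmuller

/-! ### Teichmüller representatives of residue classes -/

section Residue

variable {A : Type*} [CommRing A] [IsLocalRing A]

local notation "q" => Nat.card (A ⧸ maximalIdeal A)

section

variable {B : Type*} [CommRing B] [Algebra A B] [Algebra.IsIntegral A B] (Q : Ideal B)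
  [Q.IsMaximal]

variable (A) in
theorem under_eq_maximalIdeal : Q.under A = maximalIdeal A :=
  eq_maximalIdeal (Ideal.isMaximal_comap_of_isIntegral_of_isMaximal Q)

theorem map_maximalIdeal_le : (maximalIdeal A).map (algebraMap A B) ≤ Q :=
  Ideal.map_le_iff_le_comap.mpr (under_eq_maximalIdeal A Q).ge

variable [Finite (ResidueField A)]

theorem exists_pow_card_sub_self_mem (x : B) : ∃ m, 0 < m ∧ x ^ q ^ m - x ∈ Q := by
  have : Q.LiesOver (maximalIdeal A) := ⟨(under_eq_maximalIdeal A Q).symm⟩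
  let _ := Ideal.Quotient.field Q
  let _ := Ideal.Quotient.field (maximalIdeal A)
  have : Finite (A ⧸ maximalIdeal A) := ‹Finite (ResidueField A)›
  let F := IntermediateField.adjoin (A ⧸ maximalIdeal A) {Ideal.Quotient.mk Q x}
  have : FiniteDimensional (A ⧸ maximalIdeal A) F :=
    IntermediateField.adjoin.finiteDimensional (Algebra.IsIntegral.isIntegral _)
  have : Finite F := Module.finite_of_finite (A ⧸ maximalIdeal A)
  have := Fintype.ofFinite F
  refine ⟨Module.finrank (A ⧸ maximalIdeal A) F, Module.finrank_pos, ?_⟩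
  rw [← Module.natCard_eq_pow_finrank (K := A ⧸ maximalIdeal A) (V := F),
    Nat.card_eq_fintype_card, ← Ideal.Quotient.eq_zero_iff_mem, map_sub, map_pow, sub_eq_zero]
  exact congrArg Subtype.val (FiniteField.pow_card
    (⟨Ideal.Quotient.mk Q x, IntermediateField.mem_adjoin_simple_self _ _⟩ : F))

end

/-- If `n` lies in the maximal ideal of `A`, then `Xⁿ - X` is separable over every field
containing `A`. -/
theorem separable_X_pow_sub_X {n : ℕ} (hn : 2 ≤ n) (hmem : (n : A) ∈ maximalIdeal A)
    (F : Type*) [Field F] [Algebra A F] [FaithfulSMul A F] :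
    (Polynomial.X ^ n - Polynomial.X : Polynomial F).Separable := by
  have hne : (n : F) - 1 ≠ 0 := by
    intro h
    have h' : (n : A) - 1 = 0 := by
      apply FaithfulSMul.algebraMap_injective A F
      simpa using h
    exact (Ideal.ne_top_iff_one _).mp (maximalIdeal.isMaximal A).ne_top
      (by rwa [← sub_eq_zero.mp h'])
  obtain ⟨k, rfl⟩ : ∃ k, n = k + 2 := ⟨n - 2, by omega⟩
  set c : F := (((k + 2 : ℕ) : F) - 1)⁻¹
  have hc : (Polynomial.C c) * (((k + 2 : ℕ) : Polynomial F) - 1) = 1 := by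
    rw [← Polynomial.C_eq_natCast, ← Polynomial.C_1, ← Polynomial.C_sub, ← Polynomial.C_mul,
      inv_mul_cancel₀ hne, Polynomial.C_1]
  -- With `f = Xⁿ - X` and `c = (n - 1)⁻¹`, one has `X = c (X f' - n f)` and `1 = n Xⁿ⁻² X - f'`.
  refine ⟨-(((k + 2 : ℕ) : Polynomial F) ^ 2 * Polynomial.X ^ k * Polynomial.C c),
    ((k + 2 : ℕ) : Polynomial F) * Polynomial.X ^ k * Polynomial.C c * Polynomial.X - 1, ?_⟩
  simp only [Polynomial.derivative_sub, Polynomial.derivative_X_pow, Polynomial.derivative_X,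
    show k + 2 - 1 = k + 1 by omega, Polynomial.C_eq_natCast]
  linear_combination (((k + 2 : ℕ) : Polynomial F) * Polynomial.X ^ k * Polynomial.X) * hc

/-- Every residue class of the integral closure contains a Teichmüller element: `X ^ (qᵐ) - X`
splits into linear factors, and one of them takes a value in the maximal ideal. -/
theorem exists_teichmuller_sub_mem [Finite (ResidueField A)] {F : Type*} [Field F] [IsSepClosed F]
    [Algebra A F] [FaithfulSMul A F] (Q : Ideal (integralClosure A F)) [Q.IsMaximal]
    (x : integralClosure A F) :
    ∃ t ∈ teichmuller A (integralClosure A F), x - t ∈ Q := by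
  obtain ⟨m, hm, h⟩ := exists_pow_card_sub_self_mem (A := A) Q x
  have h2 : 2 ≤ q ^ m := (two_le_card A).trans (Nat.le_self_pow hm.ne' _)
  set f : Polynomial F := Polynomial.X ^ q ^ m - Polynomial.X with hf
  have hsplit := (IsSepClosed.splits_of_separable f
    (separable_X_pow_sub_X h2 (natCast_card_pow_mem A hm) F)).eq_prod_roots_of_monic
    (Polynomial.monic_X_pow_sub (by rw [Polynomial.degree_X]; exact_mod_cast h2))
  have hroot : ∀ t ∈ f.roots, t ^ q ^ m = t := fun t ht => by
    have := (Polynomial.mem_roots'.mp ht).2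
    simpa [hf, sub_eq_zero] using this
  have hint : ∀ t ∈ f.roots, t ∈ integralClosure A F := fun t ht =>
    ⟨Polynomial.X ^ q ^ m - Polynomial.X,
      Polynomial.monic_X_pow_sub (by rw [Polynomial.degree_X]; exact_mod_cast h2),
      by simp [hroot t ht]⟩
  lift f.roots to Multiset (integralClosure A F) using hint with s hs
  have hprod : x ^ q ^ m - x = (s.map fun t => x - t).prod := by
    apply Subtype.ext
    have := congrArg (Polynomial.eval (x : F)) hsplit
    rw [Polynomial.eval_multiset_prod, Multiset.map_map, Multiset.map_map] at this
    rw [← Subalgebra.coe_val, map_multiset_prod, Multiset.map_map]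
    simpa [hf, Function.comp_def] using this
  rw [hprod, Ideal.IsPrime.multiset_prod_mem_iff_exists_mem inferInstance] at h
  obtain ⟨_, hy, hyQ⟩ := h
  obtain ⟨t, ht, rfl⟩ := Multiset.mem_map.mp hy
  exact ⟨t, ⟨m, hm, Subtype.ext (hroot t (Multiset.mem_map_of_mem _ ht))⟩, hyQ⟩

end Residue

/-! ### Inertia and Frobenius in a separable closure -/

section SepClosure

variable {A : Type*} [CommRing A] [IsDomain A] [IsDiscreteValuationRing A]
  [Finite (ResidueField A)]
  {K : Type*} [Field K] [Algebra A K]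
  {Ksep : Type*} [Field Ksep] [Algebra K Ksep]
  [Algebra A Ksep] [IsScalarTower A K Ksep]
  (Q : Ideal (integralClosure A Ksep)) [Q.IsMaximal]

/-- As the integral closure is local, every automorphism preserves its maximal ideal. -/
theorem smul_mem [IsAdicComplete (maximalIdeal A) A] {x : integralClosure A Ksep}
    (σ : Gal(Ksep/K)) (hx : x ∈ Q) : σ • x ∈ Q := by
  obtain ⟨n, -, h⟩ := exists_pow_mem_map_maximalIdeal (A := A)
    (Ideal.IsMaximal.ne_top ‹_›) (map_maximalIdeal_le Q) hx
  have := algHom_apply_mem_map (MulSemiringAction.toAlgHom A (integralClosure A Ksep) σ) _ h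
  rw [map_pow] at this
  exact Ideal.IsPrime.mem_of_pow_mem inferInstance n (map_maximalIdeal_le Q this)

variable [IsFractionRing A K]

omit [Finite (ResidueField A)] in
theorem exists_smul_mem_adjoin (T : Set (integralClosure A Ksep)) {y : Ksep}
    (hy : y ∈ Algebra.adjoin K (Subtype.val '' T)) :
    ∃ a : A, a ≠ 0 ∧ ∃ c ∈ Algebra.adjoin A T, algebraMap A Ksep a * y = c := by
  induction hy using Algebra.adjoin_induction with
  | mem y hy =>
    obtain ⟨t, ht, rfl⟩ := hy
    exact ⟨1, one_ne_zero, t, Algebra.subset_adjoin ht, by rw [map_one, one_mul]⟩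
  | algebraMap k =>
    obtain ⟨a, b, hb, rfl⟩ := IsFractionRing.div_surjective (A := A) k
    have hb0 := nonZeroDivisors.ne_zero hb
    refine ⟨b, hb0, algebraMap A _ a, Subalgebra.algebraMap_mem _ a, ?_⟩
    rw [IsScalarTower.algebraMap_apply A K Ksep, ← map_mul, mul_div_cancel₀]
    · exact (IsScalarTower.algebraMap_apply A K Ksep a).symm
    · simpa using hb0
  | add x y _ _ hx hy =>
    obtain ⟨a, ha, c, hc, hac⟩ := hx
    obtain ⟨b, hb, d, hd, hbd⟩ := hy
    refine ⟨a * b, mul_ne_zero ha hb, b • c + a • d,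
      add_mem (Subalgebra.smul_mem _ hc b) (Subalgebra.smul_mem _ hd a), ?_⟩
    rw [Subalgebra.coe_add, Subalgebra.coe_smul, Subalgebra.coe_smul, ← hac, ← hbd,
      Algebra.smul_def, Algebra.smul_def, map_mul]
    ring
  | mul x y _ _ hx hy =>
    obtain ⟨a, ha, c, hc, hac⟩ := hx
    obtain ⟨b, hb, d, hd, hbd⟩ := hy
    refine ⟨a * b, mul_ne_zero ha hb, c * d, mul_mem hc hd, ?_⟩
    rw [Subalgebra.coe_mul, ← hac, ← hbd, map_mul]
    ring

/-- On the subfield generated by the Teichmüller elements, which is the maximal unramified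
extension, a uniformizer of `A` divides every element of the maximal ideal. -/
theorem dvd_of_mem_adjoin_teichmuller [IsAdicComplete (maximalIdeal A) A] {π : A}
    (hπ : Irreducible π) [Algebra.IsAlgebraic K Ksep] {y : integralClosure A Ksep}
    (hy : (y : Ksep) ∈ IntermediateField.adjoin K
      (Subtype.val '' teichmuller A (integralClosure A Ksep))) (hyQ : y ∈ Q) :
    algebraMap A _ π ∣ y := by
  set T := teichmuller A (integralClosure A Ksep)
  have hmax : maximalIdeal A = Ideal.span {π} := hπ.maximalIdeal_eq
  have hπ0 : algebraMap A (integralClosure A Ksep) π ≠ 0 := by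
    have : FaithfulSMul A Ksep := FaithfulSMul.trans A K Ksep
    intro h
    refine hπ.ne_zero (FaithfulSMul.algebraMap_injective A Ksep ?_)
    rw [map_zero]
    exact congrArg Subtype.val h
  -- The subring generated by the Teichmüller elements is unramified.
  have hC : ∀ c ∈ Algebra.adjoin A T, c ∈ Q →
      ∃ d ∈ Algebra.adjoin A T, c = algebraMap A _ π * d := by
    intro c hc hcQ
    set C := Algebra.adjoin A T
    have : Algebra.IsIntegral A C :=
      Algebra.IsIntegral.of_injective C.val Subtype.val_injective
    have htop : Algebra.adjoin A (teichmuller A C) = ⊤ := by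
      rw [← Algebra.adjoin_adjoin_coe_preimage (R := A) (s := T)]
      congr 1
      ext t
      exact ⟨fun ⟨m, hm, h⟩ => ⟨m, hm, congrArg Subtype.val h⟩,
        fun ⟨m, hm, h⟩ => ⟨m, hm, Subtype.ext h⟩⟩
    have := mem_map_maximalIdeal_of_adjoin_eq_top htop (P := Q.comap C.val)
      (Ideal.comap_ne_top _ (Ideal.IsMaximal.ne_top ‹_›))
      (Ideal.map_le_iff_le_comap.mpr fun a ha =>
        map_maximalIdeal_le Q (Ideal.mem_map_of_mem (algebraMap A _) ha))
      (w := ⟨c, hc⟩) hcQ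
    rw [hmax, Ideal.map_span, Set.image_singleton, Ideal.mem_span_singleton] at this
    obtain ⟨d, hd⟩ := this
    exact ⟨d, d.2, congrArg Subtype.val hd⟩
  have hind : ∀ n : ℕ, algebraMap A _ π ^ n * y ∈ Algebra.adjoin A T →
      algebraMap A (integralClosure A Ksep) π ∣ y := by
    intro n
    induction n with
    | zero =>
      intro h
      rw [pow_zero, one_mul] at h
      obtain ⟨d, -, hd⟩ := hC y h hyQ
      exact ⟨d, hd⟩
    | succ n ih =>
      intro h
      obtain ⟨d, hd, h⟩ := hC _ h (Q.mul_mem_left _ hyQ)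
      rw [pow_succ', mul_assoc] at h
      exact ih (mul_left_cancel₀ hπ0 h ▸ hd)
  rw [← IntermediateField.mem_toSubalgebra,
    IntermediateField.adjoin_toSubalgebra_of_isAlgebraic
      fun x _ => Algebra.IsAlgebraic.isAlgebraic x] at hy
  obtain ⟨a, ha, c, hc, hac⟩ := exists_smul_mem_adjoin T hy
  obtain ⟨n, u, rfl⟩ := IsDiscreteValuationRing.eq_unit_mul_pow_irreducible ha hπ
  refine hind n ?_
  have : algebraMap A _ π ^ n * y = (↑u⁻¹ : A) • c := by
    have hc' : c = algebraMap A _ (u * π ^ n) * y := Subtype.ext hac.symm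
    rw [hc', Algebra.smul_def, ← mul_assoc, ← map_mul, ← mul_assoc, Units.inv_mul, one_mul,
      map_pow]
  rw [this]
  exact Subalgebra.smul_mem _ hc _

variable [IsSepClosure K Ksep]

/-- An automorphism fixing all Teichmüller elements acts trivially on residue classes, so the
fixed field of inertia is generated by the Teichmüller elements. -/
theorem mem_adjoin_teichmuller_of_fixed [IsAdicComplete (maximalIdeal A) A] {y : Ksep}
    (hy : ∀ σ ∈ Q.inertia Gal(Ksep/K), σ y = y) :
    y ∈ IntermediateField.adjoin K
      (Subtype.val '' teichmuller A (integralClosure A Ksep)) := by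
  have : IsSepClosed Ksep := IsSepClosure.sep_closed K
  have : FaithfulSMul A Ksep := FaithfulSMul.trans A K Ksep
  rw [← InfiniteGalois.fixedField_fixingSubgroup (IntermediateField.adjoin K
      (Subtype.val '' teichmuller A (integralClosure A Ksep))),
    IntermediateField.mem_fixedField_iff]
  intro σ hσ
  rw [IntermediateField.mem_fixingSubgroup_iff] at hσ
  refine hy σ fun x => ?_
  obtain ⟨t, ht, hxt⟩ := exists_teichmuller_sub_mem Q x
  have hσt : σ • t = t :=
    Subtype.ext (hσ t (IntermediateField.subset_adjoin _ _ ⟨t, ht, rfl⟩))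
  have : σ • x - x = σ • (x - t) - (x - t) := by rw [smul_sub, hσt]; ring
  rw [this]
  exact Q.sub_mem (smul_mem Q σ hxt) hxt

/-- A lift of the Frobenius automorphism of the residue field exists because the decomposition
group surjects onto the automorphisms of the residue field, also in the profinite case. -/
theorem exists_isArithFrobAt : ∃ σ : Gal(Ksep/K), IsArithFrobAt A σ Q := by
  have hQ := under_eq_maximalIdeal A Q
  have : Q.LiesOver (maximalIdeal A) := ⟨hQ.symm⟩
  let _ : TopologicalSpace (integralClosure A Ksep) := ⊥
  have : DiscreteTopology (integralClosure A Ksep) := ⟨rfl⟩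
  have : ContinuousSMul Gal(Ksep/K) (integralClosure A Ksep) := by
    rw [continuousSMul_iff_stabilizer_isOpen]
    intro x
    convert stabilizer_isOpen_of_isIntegral (K := K) (x : Ksep) using 1
    ext σ
    simp [MulAction.mem_stabilizer_iff, Subtype.ext_iff]
  have : Algebra.IsInvariant A (integralClosure A Ksep) Gal(Ksep/K) := by
    refine ⟨fun b hb => ?_⟩
    obtain ⟨k, hk⟩ := IntermediateField.mem_bot.mp
      ((InfiniteGalois.mem_bot_iff_fixed (k := K) (b : Ksep)).mpr
        fun σ => congrArg Subtype.val (hb σ))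
    have hint : IsIntegral A k := by
      rw [← isIntegral_algebraMap_iff (algebraMap K Ksep).injective, hk]
      exact b.2
    obtain ⟨a, rfl⟩ := IsIntegrallyClosed.isIntegral_iff.mp hint
    exact ⟨a, Subtype.ext (by rw [← hk, ← IsScalarTower.algebraMap_apply A K Ksep]; rfl)⟩
  have hint : Algebra.IsIntegral (A ⧸ maximalIdeal A) (integralClosure A Ksep ⧸ Q) :=
    inferInstance
  let _ := Ideal.Quotient.field Q
  let _ := Ideal.Quotient.field (maximalIdeal A)
  have : Algebra.IsAlgebraic (A ⧸ maximalIdeal A) (integralClosure A Ksep ⧸ Q) :=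
    hint.isAlgebraic
  have : Finite (A ⧸ maximalIdeal A) := ‹Finite (ResidueField A)›
  have := Fintype.ofFinite (A ⧸ maximalIdeal A)
  obtain ⟨σ, hσ⟩ := Ideal.Quotient.stabilizerHom_surjective_of_profinite (G := Gal(Ksep/K))
    (maximalIdeal A) Q
    (FiniteField.frobeniusAlgEquivOfAlgebraic (A ⧸ maximalIdeal A) (integralClosure A Ksep ⧸ Q))
  refine ⟨σ.1, fun x => ?_⟩
  rw [hQ, ← Ideal.Quotient.eq, Nat.card_eq_fintype_card]
  exact DFunLike.congr_fun hσ (Ideal.Quotient.mk Q x)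

end SepClosure
/-! ### Rigidity of homomorphisms compatible with a power of Frobenius -/

section Rigidity

variable {A : Type*} [CommRing A] {B : Type*} [CommRing B] [Algebra A B]

theorem iterate_sub_pow_mem (I : Ideal A) (ψ : B →ₐ[A] B) {n : ℕ}
    (hψ : ∀ x, ψ x - x ^ n ∈ I.map (algebraMap A B)) (m : ℕ) (x : B) :
    ψ^[m] x - x ^ n ^ m ∈ I.map (algebraMap A B) := by
  induction m generalizing x with
  | zero => simp
  | succ m ih =>
    have h1 := ih (ψ x)
    have h2 : (ψ x) ^ n ^ m - (x ^ n) ^ n ^ m ∈ I.map (algebraMap A B) :=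
      Ideal.mem_of_dvd _ (sub_dvd_pow_sub_pow _ _ _) (hψ x)
    have := Ideal.add_mem _ h1 h2
    rw [← pow_mul, ← pow_succ'] at this
    simpa using this

/-- Modulo an ideal containing `n`, the `n`-th power map has derivative zero. -/
theorem pow_sub_pow_mem_mul {R : Type*} [CommRing R] {Q J : Ideal R} {n : ℕ} (hn : (n : R) ∈ Q)
    {x y : R} (hxy : x - y ∈ J) (hJ : J ≤ Q) : x ^ n - y ^ n ∈ Q * J := by
  rw [← geom_sum₂_mul]
  refine Ideal.mul_mem_mul ?_ hxy
  have h : Ideal.Quotient.mk Q x = Ideal.Quotient.mk Q y := Ideal.Quotient.eq.mpr (hJ hxy)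
  have hn' : (n : R ⧸ Q) = 0 := by
    rw [← map_natCast (Ideal.Quotient.mk Q), Ideal.Quotient.eq_zero_iff_mem]; exact hn
  rw [← Ideal.Quotient.eq_zero_iff_mem, map_sum]
  simp only [map_mul, map_pow, h]
  rw [Finset.sum_congr rfl (g := fun _ => Ideal.Quotient.mk Q y ^ (n - 1))]
  · simp [hn']
  · intro i hi
    rw [← pow_add]
    congr 1
    have := Finset.mem_range.mp hi
    omega

/-- Let `φ` be a self-map of a finite algebra `B` that lifts an `n`-th power map, where `n` is
zero modulo `Q`. Two homomorphisms from `B` to a domain that are invariant under `φ` and agree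
modulo `Q` are equal: the ideal `J` generated by the values of their difference satisfies
`J = Q J`. -/
theorem algHom_eq_of_sub_mem [Module.Finite A B] {C : Type*} [CommRing C] [IsDomain C]
    [Algebra A C] {I : Ideal A} {Q : Ideal C} (hQ : Q ≠ ⊤) (hI : I.map (algebraMap A C) ≤ Q)
    {n : ℕ} (hn : (n : C) ∈ Q) {φ : B → B} (hφ : ∀ x, φ x - x ^ n ∈ I.map (algebraMap A B))
    {f g : B →ₐ[A] C} (hf : ∀ x, f (φ x) = f x) (hg : ∀ x, g (φ x) = g x)
    (hfg : ∀ x, f x - g x ∈ Q) : f = g := by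
  set d : B →ₗ[A] C := f.toLinearMap - g.toLinearMap with hd
  have hd' : ∀ x, d x = f x - g x := fun _ => rfl
  set J : Ideal C := Ideal.span (Set.range d)
  have hdJ : ∀ x, d x ∈ J := fun x => Ideal.subset_span ⟨x, rfl⟩
  have hJQ : J ≤ Q := Ideal.span_le.mpr (by rintro _ ⟨x, rfl⟩; exact hfg x)
  have hJfg : J.FG := by
    obtain ⟨s, hs⟩ := Module.Finite.fg_top (R := A) (M := B)
    classical
    refine ⟨s.image d, le_antisymm (Ideal.span_mono (by simp [Set.image_subset_iff]))
      (Ideal.span_le.mpr ?_)⟩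
    rintro _ ⟨x, rfl⟩
    have hx : x ∈ Submodule.span A (s : Set B) := hs ▸ Submodule.mem_top
    have h1 : d x ∈ (Submodule.span A (s : Set B)).map d := Submodule.mem_map_of_mem hx
    rw [Submodule.map_span] at h1
    rw [Finset.coe_image]
    exact Submodule.span_subset_span A C _ h1
  have hdI : ∀ z ∈ I.map (algebraMap A B), d z ∈ Q * J := by
    intro z hz
    have hz' : z ∈ (I • ⊤ : Submodule A B) := by rw [Ideal.smul_top_eq_map]; exact hz
    refine Submodule.smul_induction_on (p := fun z => d z ∈ Q * J) hz' (fun a ha b _ => ?_)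
      (fun x y hx hy => ?_)
    · rw [map_smul, Algebra.smul_def]
      exact Ideal.mul_mem_mul (hI (Ideal.mem_map_of_mem _ ha)) (hdJ b)
    · rw [map_add]
      exact Ideal.add_mem _ hx hy
  have hJ : J ≤ Q • J := Ideal.span_le.mpr (by
    rintro _ ⟨x, rfl⟩
    have h1 : d x = (f x ^ n - g x ^ n) + d (φ x - x ^ n) := by
      simp only [hd', map_sub, map_pow, hf, hg]
      ring
    rw [h1]
    exact Ideal.add_mem _ (pow_sub_pow_mem_mul hn (hdJ x) hJQ) (hdI _ (hφ x)))
  obtain ⟨r, hr, hrJ⟩ := Submodule.exists_sub_one_mem_and_smul_eq_zero_of_fg_of_le_smul Q J hJfg hJ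
  have hr0 : r ≠ 0 := by
    rintro rfl
    exact hQ ((Ideal.eq_top_iff_one Q).mpr (by simpa using hr))
  ext x
  have := hrJ _ (hdJ x)
  rw [smul_eq_mul, mul_eq_zero] at this
  exact sub_eq_zero.mp (this.resolve_left hr0)

end Rigidity

/-! ### Integral elements of étale algebras -/

section Etale

theorem exists_maximalSpectrum_notMem (K : Type*) [Field K] {E : Type*} [CommRing E]
    [Algebra K E] [Module.Finite K E] [Algebra.Etale K E] {x : E} (hx : x ≠ 0) :
    ∃ M : MaximalSpectrum E, x ∉ M.asIdeal := by
  have : IsArtinianRing E := .of_finite K E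
  have : IsReduced E := Algebra.FormallyUnramified.isReduced_of_field K E
  by_contra! h
  refine hx ?_
  have hn : x ∈ nilradical E := by
    rw [nilradical_eq_sInf, Ideal.mem_sInf]
    intro P hP
    have : P.IsPrime := hP
    exact h ⟨P, IsArtinianRing.isMaximal_of_isPrime P⟩
  exact (mem_nilradical.mp hn).eq_zero

variable {K : Type*} [Field K] {E : Type*} [CommRing E] [Algebra K E] [Module.Finite K E]
  [Algebra.Etale K E]

/-- The homomorphisms into a separably closed field separate the points of an étale algebra. -/
theorem exists_algHom_apply_ne_zero (F : Type*) [Field F] [Algebra K F] [IsSepClosed F] {x : E}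
    (hx : x ≠ 0) : ∃ s : E →ₐ[K] F, s x ≠ 0 := by
  obtain ⟨M, hM⟩ := exists_maximalSpectrum_notMem K hx
  have := M.isMaximal
  let _ := Ideal.Quotient.field M.asIdeal
  have : Algebra.IsSeparable K (E ⧸ M.asIdeal) := inferInstance
  refine ⟨(IsSepClosed.lift : (E ⧸ M.asIdeal) →ₐ[K] F).comp (Ideal.Quotient.mkₐ K M.asIdeal), ?_⟩
  rw [AlgHom.comp_apply, map_ne_zero]
  exact fun h => hM (Ideal.Quotient.eq_zero_iff_mem.mp h)

variable {A : Type*} [CommRing A] [Algebra A K] [Algebra A E] [IsScalarTower A K E]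

theorem isIntegral_of_forall_algHom (F : Type*) [Field F] [Algebra K F] [IsSepClosed F]
    [Algebra A F] [IsScalarTower A K F] {x : E} (h : ∀ s : E →ₐ[K] F, IsIntegral A (s x)) :
    IsIntegral A x := by
  have := Fintype.ofFinite (E →ₐ[K] F)
  choose p hp hpx using h
  refine ⟨∏ s, p s, Polynomial.monic_prod_of_monic _ _ fun s _ => hp s, ?_⟩
  by_contra hne
  obtain ⟨s, hs⟩ := exists_algHom_apply_ne_zero (K := K) F hne
  refine hs ?_
  rw [← Polynomial.aeval_def, ← AlgHom.restrictScalars_apply A s, ← Polynomial.aeval_algHom_apply,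
    map_prod]
  exact Finset.prod_eq_zero (Finset.mem_univ s) (hpx s)

variable (A K E) in
/-- The integral closure embeds into the product of those in the residue fields of `E`, which are
finite separable over `K`. -/
theorem finite_integralClosure [IsDomain A] [IsFractionRing A K] [IsIntegrallyClosed A]
    [IsNoetherianRing A] : Module.Finite A (integralClosure A E) := by
  have : IsArtinianRing E := .of_finite K E
  let _ (M : MaximalSpectrum E) : Field (E ⧸ M.asIdeal) := Ideal.Quotient.field M.asIdeal
  have (M : MaximalSpectrum E) : Algebra.IsSeparable K (E ⧸ M.asIdeal) := inferInstance
  have (M : MaximalSpectrum E) : Module.Finite A (integralClosure A (E ⧸ M.asIdeal)) :=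
    IsIntegralClosure.finite A K (E ⧸ M.asIdeal) _
  let f : integralClosure A E →ₗ[A] ∀ M : MaximalSpectrum E, integralClosure A (E ⧸ M.asIdeal) :=
    LinearMap.pi fun M => (Ideal.Quotient.mkₐ A M.asIdeal).mapIntegralClosure.toLinearMap
  refine Module.Finite.of_injective f ((injective_iff_map_eq_zero f).mpr fun x hx => ?_)
  by_contra hne
  obtain ⟨M, hM⟩ := exists_maximalSpectrum_notMem K
    (fun h => hne (Subtype.ext h) : (x : E) ≠ 0)
  exact hM (Ideal.Quotient.eq_zero_iff_mem.mp (congrArg Subtype.val (congrFun hx M)))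

end Etale

/-! ### The subalgebra `R + I` -/

section Model

variable {A : Type*} [CommRing A] {E : Type*} [CommRing E] [Algebra A E]

/-- The integral elements in the image of `ψⁿ`. -/
def integralRange (ψ : E →ₐ[A] E) (n : ℕ) : Subalgebra A E :=
  integralClosure A E ⊓ (ψ ^ n).range

/-- The elements `x` in the kernel of `ψⁿ` such that `ψʲ x` is `π ^ (j + 1)` times an integral
element, for all `j`. The exponents are such that `ψ` becomes divisible by `π` on this module. -/
def divisibleKer (π : A) (ψ : E →ₐ[A] E) (n : ℕ) : Submodule A E where
  carrier := {x | (ψ ^ n) x = 0 ∧ ∀ j, ∃ y ∈ integralClosure A E, (ψ ^ j) x = π ^ (j + 1) • y}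
  zero_mem' := ⟨map_zero _, fun _ => ⟨0, zero_mem _, by simp⟩⟩
  add_mem' := by
    rintro x x' ⟨hx, h⟩ ⟨hx', h'⟩
    refine ⟨by rw [map_add, hx, hx', add_zero], fun j => ?_⟩
    obtain ⟨y, hy, e⟩ := h j
    obtain ⟨y', hy', e'⟩ := h' j
    exact ⟨y + y', add_mem hy hy', by rw [map_add, e, e', smul_add]⟩
  smul_mem' := by
    rintro a x ⟨hx, h⟩
    refine ⟨by rw [map_smul, hx, smul_zero], fun j => ?_⟩
    obtain ⟨y, hy, e⟩ := h j
    exact ⟨a • y, Subalgebra.smul_mem _ hy a, by rw [map_smul, e, smul_comm]⟩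

variable {π : A} {ψ : E →ₐ[A] E} {n : ℕ}

theorem mul_mem_divisibleKer {z x : E} (hz : z ∈ integralClosure A E)
    (hx : x ∈ divisibleKer π ψ n) : z * x ∈ divisibleKer π ψ n := by
  refine ⟨by rw [map_mul, hx.1, mul_zero], fun j => ?_⟩
  obtain ⟨y, hy, e⟩ := hx.2 j
  exact ⟨(ψ ^ j) z * y, mul_mem (hz.map (ψ ^ j)) hy, by rw [map_mul, e, mul_smul_comm]⟩

theorem exists_eq_smul_of_mem_divisibleKer {x : E} (hx : x ∈ divisibleKer π ψ n) :
    ∃ y ∈ integralClosure A E, x = π • y := by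
  simpa using hx.2 0

theorem mem_integralClosure_of_mem_divisibleKer {x : E} (hx : x ∈ divisibleKer π ψ n) :
    x ∈ integralClosure A E := by
  obtain ⟨y, hy, rfl⟩ := exists_eq_smul_of_mem_divisibleKer hx
  exact Subalgebra.smul_mem _ hy π

theorem exists_pow_eq_smul_of_mem_divisibleKer {x : E} (hx : x ∈ divisibleKer π ψ n) {k : ℕ}
    (hk : 2 ≤ k) : ∃ z ∈ divisibleKer π ψ n, x ^ k = π • z := by
  obtain ⟨y, hy, e⟩ := exists_eq_smul_of_mem_divisibleKer hx
  refine ⟨(x ^ (k - 2) * y) * x, mul_mem_divisibleKer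
    (mul_mem (pow_mem (mem_integralClosure_of_mem_divisibleKer hx) _) hy) hx, ?_⟩
  obtain ⟨k, rfl⟩ : ∃ l, k = l + 2 := ⟨k - 2, by omega⟩
  rw [← smul_mul_assoc, ← mul_smul_comm, ← e, Nat.add_sub_cancel]
  ring

theorem exists_map_eq_smul_of_mem_divisibleKer (hπ : Function.Injective fun x : E => π • x)
    {x : E} (hx : x ∈ divisibleKer π ψ n) : ∃ z ∈ divisibleKer π ψ n, ψ x = π • z := by
  obtain ⟨y, hy, e⟩ := hx.2 1
  have e' : ψ x = π • π • y := by simpa [pow_two, mul_smul] using e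
  refine ⟨π • y, ⟨hπ ?_, fun j => ?_⟩, e'⟩
  · change π • (ψ ^ n) (π • y) = π • 0
    rw [← map_smul, ← e', ← AlgHom.mul_apply, ← pow_succ, pow_succ', AlgHom.mul_apply, hx.1,
      map_zero, smul_zero]
  · obtain ⟨z, hz, h⟩ := hx.2 (j + 1)
    refine ⟨z, hz, hπ ?_⟩
    change π • (ψ ^ j) (π • y) = π • π ^ (j + 1) • z
    rw [← map_smul, ← e', ← AlgHom.mul_apply, ← pow_succ, h, pow_succ' π (j + 1), mul_smul]

theorem map_mem_integralRange {x : E} (hx : x ∈ integralRange ψ n) : ψ x ∈ integralRange ψ n := by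
  obtain ⟨hint, y, rfl⟩ := hx
  refine ⟨hint.map ψ, ψ y, ?_⟩
  change (ψ ^ n) (ψ y) = ψ ((ψ ^ n) y)
  rw [← AlgHom.mul_apply, ← pow_succ, pow_succ', AlgHom.mul_apply]

variable (π ψ n) in
/-- The sum of `integralRange` and `divisibleKer`, which is a subalgebra because the latter
is stable under multiplication by integral elements. -/
def modelSubalgebra : Subalgebra A E where
  carrier := {x | ∃ r ∈ integralRange ψ n, ∃ i ∈ divisibleKer π ψ n, r + i = x}
  algebraMap_mem' a := ⟨_, Subalgebra.algebraMap_mem _ a, 0, zero_mem _, add_zero _⟩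
  add_mem' := by
    rintro _ _ ⟨r, hr, i, hi, rfl⟩ ⟨r', hr', i', hi', rfl⟩
    exact ⟨r + r', add_mem hr hr', i + i', add_mem hi hi', by ring⟩
  mul_mem' := by
    rintro _ _ ⟨r, hr, i, hi, rfl⟩ ⟨r', hr', i', hi', rfl⟩
    exact ⟨r * r', mul_mem hr hr', r * i' + (r' + i') * i,
      add_mem (mul_mem_divisibleKer hr.1 hi') (mul_mem_divisibleKer
        (add_mem hr'.1 (mem_integralClosure_of_mem_divisibleKer hi')) hi), by ring⟩

theorem modelSubalgebra_le_integralClosure : modelSubalgebra π ψ n ≤ integralClosure A E := by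
  rintro _ ⟨r, hr, i, hi, rfl⟩
  exact add_mem hr.1 (mem_integralClosure_of_mem_divisibleKer hi)

theorem integralRange_le_modelSubalgebra : integralRange ψ n ≤ modelSubalgebra π ψ n :=
  fun r hr => ⟨r, hr, 0, zero_mem _, add_zero r⟩

theorem mem_modelSubalgebra_of_mem_divisibleKer {x : E} (hx : x ∈ divisibleKer π ψ n) :
    x ∈ modelSubalgebra π ψ n :=
  ⟨0, zero_mem _, x, hx, zero_add x⟩

theorem map_mem_modelSubalgebra (hπ : Function.Injective fun x : E => π • x) {x : E}
    (hx : x ∈ modelSubalgebra π ψ n) : ψ x ∈ modelSubalgebra π ψ n := by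
  obtain ⟨r, hr, i, hi, rfl⟩ := hx
  obtain ⟨z, hz, e⟩ := exists_map_eq_smul_of_mem_divisibleKer hπ hi
  exact ⟨ψ r, map_mem_integralRange hr, π • z, Submodule.smul_mem _ _ hz, by rw [map_add, e]⟩

/-- If `ψ` lifts the Frobenius map on the integral elements in the image of `ψⁿ`, then it does so
on `modelSubalgebra`, because both `ψ` and the `q`-power map vanish modulo `π` on
`divisibleKer`. -/
theorem map_sub_pow_mem_of_mem_modelSubalgebra [IsLocalRing A] [Finite (ResidueField A)]
    (hmem : π ∈ maximalIdeal A) (hπ : Function.Injective fun x : E => π • x)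
    (hR : ∀ r ∈ integralRange ψ n, ∃ z ∈ integralRange ψ n,
      ψ r - r ^ Nat.card (A ⧸ maximalIdeal A) = π • z)
    (b : modelSubalgebra π ψ n) :
    (⟨ψ b, map_mem_modelSubalgebra hπ b.2⟩ : modelSubalgebra π ψ n) -
        b ^ Nat.card (A ⧸ maximalIdeal A) ∈
      (maximalIdeal A).map (algebraMap A (modelSubalgebra π ψ n)) := by
  have hsmul : ∀ z : modelSubalgebra π ψ n,
      π • z ∈ (maximalIdeal A).map (algebraMap A (modelSubalgebra π ψ n)) := fun z => by
    rw [Algebra.smul_def]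
    exact Ideal.mul_mem_right _ _ (Ideal.mem_map_of_mem _ hmem)
  obtain ⟨_, r, hr, i, hi, rfl⟩ := b
  obtain ⟨z, hz, ez⟩ := hR r hr
  obtain ⟨u, hu, eu⟩ := exists_map_eq_smul_of_mem_divisibleKer hπ hi
  obtain ⟨v, hv, ev⟩ := exists_pow_eq_smul_of_mem_divisibleKer hi (two_le_card A)
  have hadd := add_pow_card_pow_sub_mem (A := A)
    (⟨r, integralRange_le_modelSubalgebra hr⟩ : modelSubalgebra π ψ n)
    ⟨i, mem_modelSubalgebra_of_mem_divisibleKer hi⟩ 1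
  rw [pow_one] at hadd
  have h := Ideal.sub_mem _ (hsmul ⟨z + (u - v),
    add_mem (integralRange_le_modelSubalgebra hz)
      (mem_modelSubalgebra_of_mem_divisibleKer (sub_mem hu hv))⟩) hadd
  convert h using 1
  apply Subtype.ext
  change ψ (r + i) - (r + i) ^ _ =
    π • (z + (u - v)) - ((r + i) ^ _ - (r ^ _ + i ^ _))
  rw [smul_add, smul_sub, ← ez, ← eu, ← ev, map_add]
  ring

end Model

/-! ### The action on homomorphisms into a field -/

section Action

variable {A : Type*} [CommRing A] [IsDomain A] [IsDiscreteValuationRing A]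
  {K : Type*} [Field K] [Algebra A K] [IsFractionRing A K]
  {E : Type*} [CommRing E] [Algebra K E] [Algebra A E] [IsScalarTower A K E]

variable (A) in
/-- The maximal ideal of `A`, as an element of `localP A`. -/
def localPoint : localP A :=
  ⟨⟨maximalIdeal A, inferInstance⟩, rfl⟩

instance : Subsingleton (localP A) :=
  ⟨fun x y => Subtype.ext (x.2.trans y.2.symm)⟩

namespace LambdaStructure

variable (L : LambdaStructure A (localP A) E) {F : Type*} [Field F] [Algebra K F]

variable (F) in
/-- The map `s ↦ s ∘ ψ` by which the maximal ideal of `A` acts. -/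
noncomputable def shift : (E →ₐ[K] F) → (E →ₐ[K] F) :=
  L.action K F (1, localPrime A)

theorem shift_apply (s : E →ₐ[K] F) (x : E) :
    L.shift F s x = s (L.psi (localPoint A) x) := by
  change s (L.psiIdeal (localPrime A) x) = _
  rw [localPrime, L.psiIdeal_ofPrime]
  rfl

theorem action_gal_apply (σ : Gal(F/K)) (s : E →ₐ[K] F) (x : E) :
    L.action K F (σ, 1) s x = σ (s x) := by
  change σ (s (L.psiIdeal 1 x)) = _
  rw [map_one, AlgHom.one_apply]

theorem action_localPrime_pow (n : ℕ) :
    L.action K F (1, localPrime A ^ n) = (L.shift F)^[n] := by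
  have h : ((1, localPrime A ^ n) : Gal(F/K) × IdP A (localP A)) = (1, localPrime A) ^ n := by
    rw [Prod.pow_mk, one_pow]
  rw [h, map_pow]
  exact hom_coe_pow (fun f : Function.End (E →ₐ[K] F) => (f : (E →ₐ[K] F) → (E →ₐ[K] F)))
    rfl (fun _ _ => rfl) _ _

theorem iterate_shift_apply (n : ℕ) (s : E →ₐ[K] F) (x : E) :
    (L.shift F)^[n] s x = s ((L.psi (localPoint A) ^ n) x) := by
  induction n generalizing s with
  | zero => rfl
  | succ n ih =>
    rw [Function.iterate_succ_apply, ih, shift_apply, pow_succ', AlgHom.mul_apply]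

theorem commute_shift (σ : Gal(F/K)) :
    Function.Commute (L.action K F (σ, 1)) (L.shift F) := by
  intro s
  ext x
  rw [action_gal_apply, shift_apply, shift_apply, action_gal_apply]

theorem mem_Sunr_iff [Module.Finite K E] (s : E →ₐ[K] F) :
    s ∈ L.Sunr K F ↔ s ∈ Function.periodicPts (L.shift F) := by
  simp only [Sunr, Set.mem_iInter, action_localPrime_pow]
  refine ⟨fun h => ?_, mem_range_iterate_of_mem_periodicPts⟩
  obtain ⟨t, rfl⟩ := h (Nat.card (E →ₐ[K] F))
  exact iterate_mem_periodicPts _ _ le_rfl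

end LambdaStructure

/-! ### Consequences of the existence of an integral model -/

omit [IsDomain A] [IsDiscreteValuationRing A] [IsFractionRing A K] in
theorem algHom_ext_of_surjective (B : Subalgebra A E)
    (hB : Function.Surjective (B.val.toLinearMap.liftBaseChange K)) {R : Type*} [CommRing R]
    [Algebra K R] {s t : E →ₐ[K] R} (h : ∀ b : B, s b = t b) : s = t := by
  ext x
  obtain ⟨z, rfl⟩ := hB x
  induction z with
  | zero => simp
  | add x y hx hy => rw [map_add, map_add, map_add, hx, hy]
  | tmul k b => simp [h b]

variable {Ksep : Type*} [Field Ksep] [Algebra K Ksep] [Algebra A Ksep] [IsScalarTower A K Ksep]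

/-- The restriction of `s : E → Kˢ` to a subalgebra of integral elements, as a homomorphism into
the integral closure. -/
def restrictIntegral (B : Subalgebra A E) [Algebra.IsIntegral A B] (s : E →ₐ[K] Ksep) :
    B →ₐ[A] integralClosure A Ksep :=
  ((s.restrictScalars A).comp B.val).codRestrict (integralClosure A Ksep) fun b =>
    (Algebra.IsIntegral.isIntegral (R := A) b).map ((s.restrictScalars A).comp B.val)

variable [Finite (ResidueField A)]
  (Q : Ideal (integralClosure A Ksep)) [Q.IsMaximal]

/-- On a `Λ`-stable order two homomorphisms in `S_unr` that agree modulo the maximal ideal are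
equal. -/
theorem LambdaStructure.IsIntegralModel.eq_of_sub_mem {L : LambdaStructure A (localP A) E}
    {B : Subalgebra A E} (hB : L.IsIntegralModel K B) [Module.Finite A B] {s t : E →ₐ[K] Ksep}
    (hs : s ∈ Function.periodicPts (L.shift Ksep))
    (ht : t ∈ Function.periodicPts (L.shift Ksep))
    (h : ∀ b : B, restrictIntegral B s b - restrictIntegral B t b ∈ Q) : s = t := by
  obtain ⟨L', hL'⟩ := hB.exists_lambdaStructure
  obtain ⟨m, hm, hs⟩ := hs
  obtain ⟨n, hn, ht⟩ := ht
  have hs := hs.mul_const n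
  have ht := ht.const_mul m
  have hψ : ∀ k (b : B), (((L'.psi (localPoint A))^[k] b : B) : E)
      = (L.psi (localPoint A) ^ k) b := by
    intro k b
    induction k with
    | zero => rfl
    | succ k ih => rw [Function.iterate_succ_apply', hL', ih, pow_succ', AlgHom.mul_apply]
  have hinv : ∀ u : E →ₐ[K] Ksep,
      Function.IsPeriodicPt (L.shift Ksep) (m * n) u →
      ∀ b, restrictIntegral B u ((L'.psi (localPoint A))^[m * n] b) = restrictIntegral B u b := by
    intro u hu b
    apply Subtype.ext
    change u (((L'.psi (localPoint A))^[m * n] b : B) : E) = u b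
    rw [hψ, ← L.iterate_shift_apply, hu]
  have hcast : ((Nat.card (A ⧸ maximalIdeal A) ^ (m * n) : ℕ) : integralClosure A Ksep) ∈ Q := by
    have := map_maximalIdeal_le Q (Ideal.mem_map_of_mem (algebraMap A (integralClosure A Ksep))
      (natCast_card_pow_mem A (m := m * n) (by positivity)))
    rwa [map_natCast] at this
  have heq := algHom_eq_of_sub_mem (I := maximalIdeal A) (Ideal.IsMaximal.ne_top ‹_›)
    (map_maximalIdeal_le Q) hcast
    (iterate_sub_pow_mem (maximalIdeal A) _ (L'.isFrobeniusLift (localPoint A)) (m * n))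
    (hinv s hs) (hinv t ht) h
  exact algHom_ext_of_surjective B hB.bijective.2 fun b =>
    congrArg Subtype.val (DFunLike.congr_fun heq b)

/-- The homomorphisms to be compared take values congruent modulo `Q` on the model: for inertia by
definition, and for Frobenius because both `ψ` and `σ` induce `x ↦ x ^ q` on residue classes. -/
theorem LambdaStructure.IsIntegralModel.inertia_and_frobenius [Module.Finite K E]
    {L : LambdaStructure A (localP A) E} {B : Subalgebra A E} (hB : L.IsIntegralModel K B) :
    (∀ σ ∈ Q.inertia Gal(Ksep/K), ∀ s ∈ L.Sunr K Ksep, L.action K Ksep (σ, 1) s = s) ∧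
      (∀ σ : Gal(Ksep/K), IsArithFrobAt A σ Q → ∀ s ∈ L.Sunr K Ksep,
        L.action K Ksep (1, localPrime A) s = L.action K Ksep (σ, 1) s) := by
  have := hB.finite
  have hgal : ∀ (σ : Gal(Ksep/K)) (s : E →ₐ[K] Ksep) (b : B),
      restrictIntegral B (L.action K Ksep (σ, 1) s) b = σ • restrictIntegral B s b :=
    fun σ s b => Subtype.ext (L.action_gal_apply σ s b)
  have hper : ∀ (σ : Gal(Ksep/K)), ∀ s ∈ L.Sunr K Ksep, L.action K Ksep (σ, 1) s ∈
      Function.periodicPts (L.shift Ksep) := fun σ s hs =>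
    (L.commute_shift σ).semiconj.mapsTo_periodicPts ((L.mem_Sunr_iff s).mp hs)
  refine ⟨fun σ hσ s hs => hB.eq_of_sub_mem Q (hper σ s hs) ((L.mem_Sunr_iff s).mp hs)
    fun b => ?_, fun σ hσ s hs => hB.eq_of_sub_mem Q ?_ (hper σ s hs) fun b => ?_⟩
  · rw [hgal]
    exact hσ _
  · exact Function.Semiconj.mapsTo_periodicPts (fun _ => rfl) ((L.mem_Sunr_iff s).mp hs)
  · obtain ⟨L', hL'⟩ := hB.exists_lambdaStructure
    rw [hgal]
    have h1 : restrictIntegral B (L.action K Ksep (1, localPrime A) s) b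
        = restrictIntegral B s (L'.psi (localPoint A) b) :=
      Subtype.ext ((L.shift_apply s _).trans (congrArg s (hL' _ b).symm))
    have h2 := map_maximalIdeal_le Q (algHom_apply_mem_map (restrictIntegral B s) _
      (L'.isFrobeniusLift (localPoint A) b))
    have h3 := hσ (restrictIntegral B s b)
    rw [under_eq_maximalIdeal A Q] at h3
    rw [map_sub, map_pow] at h2
    rw [h1]
    convert Q.sub_mem h2 h3 using 1
    exact (sub_sub_sub_cancel_right _ _ _).symm

end Action

/-! ### Construction of an integral model -/

section Construction

variable {A : Type*} [CommRing A] [IsDomain A] [IsDiscreteValuationRing A]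
  {K : Type*} [Field K] [Algebra A K] [IsFractionRing A K]
  {E : Type*} [CommRing E] [Algebra K E] [Algebra A E] [IsScalarTower A K E]

theorem bijective_liftBaseChange (B : Subalgebra A E)
    (hB : ∀ x : E, ∃ a : A, a ≠ 0 ∧ a • x ∈ B) :
    Function.Bijective (B.val.toLinearMap.liftBaseChange K) := by
  have hloc : IsLocalizedModule (nonZeroDivisors A) B.val.toLinearMap := by
    refine ⟨fun a => ?_, fun x => ?_, fun h => ⟨1, by rw [Subtype.ext h]⟩⟩
    · have ha : algebraMap A K a ≠ 0 := by simp
      rw [Module.End.isUnit_iff]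
      refine ⟨fun x y h => ?_, fun y => ⟨(algebraMap A K a)⁻¹ • y, ?_⟩⟩
      · have h' : (a : A) • x = (a : A) • y := h
        rw [← algebraMap_smul K (a : A) x, ← algebraMap_smul K (a : A) y] at h'
        exact smul_right_injective E ha h'
      · change (a : A) • (algebraMap A K a)⁻¹ • y = y
        rw [← algebraMap_smul K, smul_inv_smul₀ ha]
    · obtain ⟨a, ha, hx⟩ := hB x
      exact ⟨(⟨_, hx⟩, ⟨a, mem_nonZeroDivisors_of_ne_zero ha⟩), rfl⟩
  have hbc := (isLocalizedModule_iff_isBaseChange (nonZeroDivisors A) K _).mp hloc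
  have : B.val.toLinearMap.liftBaseChange K = hbc.equiv.toLinearMap := by
    ext b
    simp [hbc.equiv_tmul]
  rw [this]
  exact hbc.equiv.bijective

omit [IsDomain A] [IsDiscreteValuationRing A] in
theorem extendScalars_pow_apply (ψ : E →ₐ[A] E) (n : ℕ) (x : E) :
    ((extendScalars K ψ).toLinearMap ^ n) x = (ψ ^ n) x := by
  induction n generalizing x with
  | zero => rfl
  | succ n ih =>
    rw [pow_succ, pow_succ, Module.End.mul_apply, AlgHom.mul_apply, ih]
    rfl

omit [IsDiscreteValuationRing A] in
/-- The model spans `E` over the fraction field, because `E` is the sum of the kernel and the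
image of `ψⁿ` for large `n` (Fitting's lemma). -/
theorem exists_smul_mem_modelSubalgebra [Module.Finite K E] {π : A} (hπ : Irreducible π)
    (ψ : E →ₐ[A] E) {n : ℕ}
    (hn : IsCompl (LinearMap.ker ((extendScalars K ψ).toLinearMap ^ n))
      (LinearMap.range ((extendScalars K ψ).toLinearMap ^ n))) (x : E) :
    ∃ a : A, a ≠ 0 ∧ a • x ∈ modelSubalgebra π ψ n := by
  have hint : ∀ y : E, ∃ a : A, a ≠ 0 ∧ a • y ∈ integralClosure A E := fun y => by
    have : IsAlgebraic A y :=
      (IsFractionRing.isAlgebraic_iff A K E).mpr (Algebra.IsAlgebraic.isAlgebraic y)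
    exact this.exists_integral_multiple
  obtain ⟨i, hi, _, ⟨y, rfl⟩, rfl⟩ := Submodule.mem_sup.mp
    (hn.sup_eq_top ▸ Submodule.mem_top : x ∈ _ ⊔ _)
  rw [LinearMap.mem_ker, extendScalars_pow_apply] at hi
  rw [extendScalars_pow_apply]
  obtain ⟨a, ha, hai⟩ := hint i
  obtain ⟨b, hb, hby⟩ := hint y
  refine ⟨(π ^ n * a) * b, mul_ne_zero (mul_ne_zero (pow_ne_zero n hπ.ne_zero) ha) hb, ?_⟩
  rw [smul_add]
  refine add_mem ?_ ?_
  · rw [mul_comm, mul_smul, mul_smul]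
    refine Subalgebra.smul_mem _ (mem_modelSubalgebra_of_mem_divisibleKer ⟨?_, fun j => ?_⟩) b
    · rw [map_smul, map_smul, hi, smul_zero, smul_zero]
    · by_cases hj : j < n
      · refine ⟨π ^ (n - (j + 1)) • (ψ ^ j) (a • i), Subalgebra.smul_mem _ (hai.map (ψ ^ j)) _, ?_⟩
        rw [map_smul, map_smul, ← mul_smul, ← mul_smul, ← pow_add, ← mul_smul,
          Nat.add_sub_cancel' (Nat.succ_le_of_lt hj)]
      · refine ⟨0, zero_mem _, ?_⟩
        obtain ⟨k, rfl⟩ := Nat.exists_eq_add_of_le' (not_lt.mp hj)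
        rw [map_smul, map_smul, pow_add, AlgHom.mul_apply, hi, map_zero, smul_zero, smul_zero,
          smul_zero]
  · rw [mul_smul, ← map_smul]
    exact Subalgebra.smul_mem _
      (integralRange_le_modelSubalgebra ⟨hby.map (ψ ^ n), b • y, rfl⟩) _

variable {Ksep : Type*} [Field Ksep] [Algebra K Ksep] [IsSepClosure K Ksep]
  [Algebra A Ksep] [IsScalarTower A K Ksep]
  [IsAdicComplete (maximalIdeal A) A] [Finite (ResidueField A)]
  (Q : Ideal (integralClosure A Ksep)) [Q.IsMaximal]

/-- If inertia acts trivially on `S_unr` and Frobenius acts as `ψ`, then `ψ` lifts the `q`-power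
map on the integral elements of the image of `ψⁿ`, for `n` so large that `s ∘ ψⁿ ∈ S_unr` for all
`s`. -/
theorem exists_map_sub_pow_eq_smul [Module.Finite K E] [Algebra.Etale K E]
    (L : LambdaStructure A (localP A) E) {π : A} (hπ : Irreducible π)
    (h1 : ∀ σ ∈ Q.inertia Gal(Ksep/K), ∀ s ∈ L.Sunr K Ksep, L.action K Ksep (σ, 1) s = s)
    (h2 : ∀ σ : Gal(Ksep/K), IsArithFrobAt A σ Q → ∀ s ∈ L.Sunr K Ksep,
      L.action K Ksep (1, localPrime A) s = L.action K Ksep (σ, 1) s)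
    {n : ℕ} (hn : Nat.card (E →ₐ[K] Ksep) ≤ n) {r : E}
    (hr : r ∈ integralRange (L.psi (localPoint A)) n) :
    ∃ z ∈ integralRange (L.psi (localPoint A)) n,
      L.psi (localPoint A) r - r ^ Nat.card (A ⧸ maximalIdeal A) = π • z := by
  have : IsSepClosed Ksep := IsSepClosure.sep_closed K
  set ψ := L.psi (localPoint A)
  set q := Nat.card (A ⧸ maximalIdeal A)
  have hπ0 : algebraMap A K π ≠ 0 := by simpa using hπ.ne_zero
  obtain ⟨σ, hσ⟩ := exists_isArithFrobAt (K := K) Q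
  set z : E := (algebraMap A K π)⁻¹ • (ψ r - r ^ q) with hz
  have hπz : ψ r - r ^ q = π • z := by
    rw [hz, ← algebraMap_smul K, smul_inv_smul₀ hπ0]
  refine ⟨z, ⟨?_, ?_⟩, hπz⟩
  · refine isIntegral_of_forall_algHom (K := K) Ksep fun s => ?_
    obtain ⟨hrint, x, hx⟩ := hr
    obtain rfl : (ψ ^ n) x = r := hx
    -- On the image of `ψⁿ`, `s` takes the values of an element of `S_unr`.
    set t := (L.shift Ksep)^[n] s
    have htunr : t ∈ L.Sunr K Ksep := (L.mem_Sunr_iff t).mpr (iterate_mem_periodicPts _ _ hn)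
    have htx : ∀ y, s ((ψ ^ n) y) = t y := fun y => (L.iterate_shift_apply n s y).symm
    have hψn : ψ ((ψ ^ n) x) = (ψ ^ n) (ψ x) := by
      rw [← AlgHom.mul_apply, ← AlgHom.mul_apply, ← pow_succ, ← pow_succ']
    have hfix : ∀ y, ∀ τ ∈ Q.inertia Gal(Ksep/K), τ (t y) = t y := fun y τ hτ => by
      rw [← L.action_gal_apply τ t, h1 τ hτ t htunr]
    have hF : t (ψ x) = σ (t x) := by
      rw [← L.action_gal_apply σ t, ← h2 σ hσ t htunr]
      exact (L.shift_apply t x).symm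
    have htint : IsIntegral A (t x) := by
      rw [← htx]
      exact hrint.map (s.restrictScalars A)
    let y : integralClosure A Ksep := ⟨t x, htint⟩
    have hyQ : σ • y - y ^ q ∈ Q := by
      have := hσ y
      rwa [under_eq_maximalIdeal A Q] at this
    have hy : ((σ • y - y ^ q : integralClosure A Ksep) : Ksep) = t (ψ x - x ^ q) := by
      change σ (t x) - (t x) ^ q = _
      rw [map_sub, map_pow, hF]
    obtain ⟨w, hw⟩ := dvd_of_mem_adjoin_teichmuller Q hπ (hy ▸ mem_adjoin_teichmuller_of_fixed Q
      (hfix (ψ x - x ^ q))) hyQ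
    have hsz : s z = w := by
      have hw' : algebraMap K Ksep (algebraMap A K π) * w = t (ψ x - x ^ q) := by
        rw [← hy, hw, ← IsScalarTower.algebraMap_apply A K Ksep]
        rfl
      rw [hz, map_smul, hψn, ← map_pow, ← map_sub, htx, ← hw', Algebra.smul_def, ← mul_assoc,
        ← map_mul, inv_mul_cancel₀ hπ0, map_one, one_mul]
    rw [hsz]
    exact w.2
  · obtain ⟨-, x, rfl⟩ := hr
    refine ⟨(algebraMap A K π)⁻¹ • (ψ x - x ^ q), ?_⟩
    change (ψ ^ n) _ = z
    rw [hz, ← extendScalars_pow_apply (K := K), map_smul, extendScalars_pow_apply, map_sub,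
      map_pow]
    congr 2
    change (ψ ^ n) (ψ x) = ψ ((ψ ^ n) x)
    rw [← AlgHom.mul_apply, ← AlgHom.mul_apply, ← pow_succ, ← pow_succ']

theorem exists_isIntegralModel [Module.Finite K E] [Algebra.Etale K E]
    (L : LambdaStructure A (localP A) E)
    (h1 : ∀ σ ∈ Q.inertia Gal(Ksep/K), ∀ s ∈ L.Sunr K Ksep, L.action K Ksep (σ, 1) s = s)
    (h2 : ∀ σ : Gal(Ksep/K), IsArithFrobAt A σ Q → ∀ s ∈ L.Sunr K Ksep,
      L.action K Ksep (1, localPrime A) s = L.action K Ksep (σ, 1) s) :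
    ∃ B : Subalgebra A E, L.IsIntegralModel K B := by
  obtain ⟨π, hπ⟩ := IsDiscreteValuationRing.exists_irreducible A
  set ψ := L.psi (localPoint A)
  obtain ⟨n, hn, hcompl⟩ := ((Filter.eventually_ge_atTop (Nat.card (E →ₐ[K] Ksep))).and
    (extendScalars K ψ).toLinearMap.eventually_isCompl_ker_pow_range_pow).exists
  have : Module.IsTorsionFree A E := Module.IsTorsionFree.trans_faithfulSMul A K E
  have hinj : Function.Injective fun x : E => π • x := smul_right_injective E hπ.ne_zero
  set B := modelSubalgebra π ψ n
  let ψB : B →ₐ[A] B := (ψ.comp B.val).codRestrict B fun b => map_mem_modelSubalgebra hinj b.2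
  have hψB : ∀ p : localP A, IsFrobeniusLift p.1 ψB := fun p => by
    obtain rfl := Subsingleton.elim p (localPoint A)
    exact map_sub_pow_mem_of_mem_modelSubalgebra
      (hπ.maximalIdeal_eq ▸ Ideal.mem_span_singleton_self π) hinj
      fun r hr => exists_map_sub_pow_eq_smul Q L hπ h1 h2 hn hr
  refine ⟨B, ⟨⟨fun _ => ψB, hψB, fun _ _ => rfl⟩, fun p b => ?_⟩, ?_, inferInstance,
    bijective_liftBaseChange B (exists_smul_mem_modelSubalgebra hπ ψ hcompl)⟩
  · obtain rfl := Subsingleton.elim p (localPoint A)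
    rfl
  · have := finite_integralClosure K E A
    have hle : B ≤ integralClosure A E := modelSubalgebra_le_integralClosure
    exact Module.Finite.of_injective (Subalgebra.inclusion hle).toLinearMap
      (Subalgebra.inclusion_injective hle)

end Construction

end LambdaRing

theorem mainTheorem1 {A : Type*} [CommRing A] [IsDomain A] [IsDiscreteValuationRing A]
    [IsAdicComplete (IsLocalRing.maximalIdeal A) A] [Finite (IsLocalRing.ResidueField A)]
    {K : Type*} [Field K] [Algebra A K] [IsFractionRing A K]
    {Ksep : Type*} [Field Ksep] [Algebra K Ksep] [IsSepClosure K Ksep]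
    [Algebra A Ksep] [IsScalarTower A K Ksep]
    (Q : Ideal (integralClosure A Ksep)) [Q.IsMaximal]
    {E : Type*} [CommRing E] [Algebra K E] [Module.Finite K E] [Algebra.Etale K E]
    [Algebra A E] [IsScalarTower A K E]
    (L : LambdaRing.LambdaStructure A (LambdaRing.localP A) E) :
    (∃ B : Subalgebra A E, L.IsIntegralModel K B) ↔
      (∀ σ ∈ Q.inertia Gal(Ksep/K), ∀ s ∈ L.Sunr K Ksep, L.action K Ksep (σ, 1) s = s) ∧
      (∀ σ : Gal(Ksep/K), IsArithFrobAt A σ Q → ∀ s ∈ L.Sunr K Ksep,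
        L.action K Ksep (1, LambdaRing.localPrime A) s = L.action K Ksep (σ, 1) s) :=
  ⟨fun ⟨_, hB⟩ => hB.inertia_and_frobenius Q,
    fun ⟨h1, h2⟩ => LambdaRing.exists_isIntegralModel Q L h1 h2⟩
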